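/- All graphs are finite, undirected and simple. An antimagic labeling of a connected graph $G$ is a bijection $\phi : E(G)\to\{1,2,\dots,|E(G)|\}$ such that the vertex sums $s(v)=\sum_{e\ni v}\phi(e)$, $v\in V(G)$, are pairwise distinct; $G$ is called antimagic if it has an antimagic labeling. Let $T$ be a tree other than $K_2$, and let $V_{even}(T)$ be the set of vertices of even degree of $T$. If the subgraph of $T$ induced by $V_{even}(T)$ is a path (a single vertex counts as a path, and $V_{even}(T)=\emptyset$ is also allowed), then $T$ is antimagic. -/

import Mathlib

namespace SimpleGraph

variable {V : Type*} [Fintype V] [DecidableEq V] (G : SimpleGraph V) [DecidableRel G.Adj]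

/-- The vertex sum at `v`: the sum of the labels of the edges incident to `v`. -/
def vertexSum (φ : G.edgeSet → ℕ) (v : V) : ℕ :=
  ∑ e ∈ Finset.univ.filter (fun e : G.edgeSet => v ∈ (e : Sym2 V)), φ e

/-- An edge labeling is antimagic if it is a bijection from the edge set onto `{1, …, |E(G)|}`
and the vertex sums are pairwise distinct. -/
def IsAntimagicLabeling (φ : G.edgeSet → ℕ) : Prop :=
  Set.BijOn φ Set.univ (Set.Icc 1 G.edgeFinset.card) ∧ Function.Injective (G.vertexSum φ)

/-- A graph is antimagic if it has an antimagic labeling. -/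
def IsAntimagic : Prop :=
  ∃ φ : G.edgeSet → ℕ, G.IsAntimagicLabeling φ

/-- The set of vertices of even degree. -/
def evenDegreeVertices : Set V :=
  {v | Even (G.degree v)}

/-- The subgraph induced by `S` is a path `v₁, …, vₙ` on `n` vertices. The case `n = 0` is that
of an empty set `S`. -/
def InducesPath {W : Type*} (H : SimpleGraph W) (S : Set W) : Prop :=
  ∃ n : ℕ, Nonempty (H.induce S ≃g pathGraph n)

end SimpleGraph

/-! Extend the path of even vertices by an odd vertex at each end to a path `v 0, …, v p`, and root
the tree at `v 0`. Labelling edges is then labelling non-root vertices by their parent edge. A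
parity count shows that every vertex has an even number of children off the path, so these edges
split into sibling pairs. Put `a = (p + 1) / 2`, let `2k` be the number of off-path vertices, and `C
= 2a + 2k + 1`. Sibling pairs share out the labels `a + 1, …, a + 2k`, each pair summing to `C`
(`exists_paired_labels`). Modulo `C`, an off-path vertex sum is thus its own label, and the sum at
`v i` involves only path labels. Those have residues `X i` in `[-a, a]` such that the sums `X i + X
(i + 1)` are distinct and again in `[-a, a]` (`exists_path_residues`). As `[-a, a]` and `[a + 1, a +
2k]` are disjoint modulo `C`, all vertex sums differ. Only `p = 1` (no even vertex) escapes: both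
path residues equal `X 1`. Starting at a leaf, the two sums are compared directly; this is where
`K₂` is excluded. -/

/-! ### Residues along the path and labels of sibling pairs -/

-- For odd `p` there is one label fewer than nonzero residues modulo `C`; the label `C - 1` does not
-- exist, hence the ban on `-1`.
set_option maxHeartbeats 800000 in
theorem exists_path_residues (p : ℕ) (hp : 1 ≤ p) :
    ∃ X : ℕ → ℤ, X 0 = 0 ∧ X (p + 1) = 0 ∧ Set.InjOn X (Set.Icc 1 p) ∧
      (∀ i ∈ Set.Icc 1 p, X i ≠ 0 ∧ |X i| ≤ ((p + 1) / 2 : ℕ) ∧ (Odd p → X i ≠ -1)) ∧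
      (p ≠ 1 → Set.InjOn (fun i => X i + X (i + 1)) (Set.Icc 0 p)) ∧
      ∀ i ∈ Set.Icc 0 p, |X i + X (i + 1)| ≤ ((p + 1) / 2 : ℕ) := by
  simp only [Set.InjOn, Set.mem_Icc, abs_le, Nat.odd_iff]
  rcases Nat.eq_or_lt_of_le hp with rfl | hp
  · refine ⟨fun i => if i = 1 then 1 else 0, ?_, ?_, ?_, ?_, ?_, ?_⟩
    · simp
    · simp
    · intro i hi j hj _; omega
    · intro i hi
      obtain rfl : i = 1 := by omega
      simp
    · simp
    · intro i hi
      obtain rfl | rfl : i = 0 ∨ i = 1 := by omega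
      all_goals simp
  have hmod : p % 2 = 0 ∨ p % 4 = 3 ∨ p % 4 = 1 := by omega
  rcases hmod with h | h | h
  · obtain ⟨c, rfl⟩ : ∃ c, p = 2 * c := ⟨p / 2, by omega⟩
    let X : ℕ → ℤ := fun i => if i % 2 = 0 then -(i / 2 : ℕ) else c - (i / 2 : ℕ)
    have hX : ∀ i, (i % 2 = 0 ∧ 2 * X i = -i) ∨ (i % 2 = 1 ∧ 2 * X i = 2 * c + 1 - i) := by
      intro i
      simp only [X]
      split_ifs <;> omega
    clear_value X
    have hS : ∀ i, X i + X (i + 1) = c - i := fun i => by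
      have := hX i
      have := hX (i + 1)
      omega
    refine ⟨X, ?_, ?_, ?_, ?_, ?_, ?_⟩
    · have := hX 0; omega
    · have := hX (2 * c + 1); omega
    · intro i hi j hj; have := hX i; have := hX j; omega
    · intro i hi; have := hX i; omega
    · intro _ i hi j hj; simp only [hS]; omega
    · intro i hi; simp only [hS]; omega
  · obtain ⟨c, rfl⟩ : ∃ c, p = 4 * c + 3 := ⟨p / 4, by omega⟩
    -- Starting the negative run at `-2` avoids `-1`. The runs swap parity in the middle, where two
    -- adjacent positive values give the sum `2c + 1` in place of `-2`.
    let X : ℕ → ℤ := fun i => if i % 2 = 0 then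
      (if i = 0 then 0 else if i ≤ 2 * c + 2 then -(i / 2 : ℕ) - 1 else 2 * c + 2 - (i / 2 : ℕ))
      else if i ≤ 2 * c + 3 then 2 * c + 2 - (i / 2 : ℕ) else -(i / 2 : ℕ) - 1
    have hX : ∀ i, (i = 0 ∧ X i = 0) ∨
        (i % 2 = 0 ∧ 0 < i ∧ i ≤ 2 * c + 2 ∧ 2 * X i = -i - 2) ∨
        (i % 2 = 0 ∧ 2 * c + 2 < i ∧ 2 * X i = 4 * c + 4 - i) ∨
        (i % 2 = 1 ∧ i ≤ 2 * c + 3 ∧ 2 * X i = 4 * c + 5 - i) ∨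
        (i % 2 = 1 ∧ 2 * c + 3 < i ∧ 2 * X i = -i - 1) := by
      intro i
      simp only [X]
      split_ifs <;> omega
    clear_value X
    have hS : ∀ i, (i = 0 ∧ X i + X (i + 1) = 2 * c + 2) ∨
        (i = 2 * c + 3 ∧ X i + X (i + 1) = 2 * c + 1) ∨
        (i ≠ 0 ∧ i ≠ 2 * c + 3 ∧ X i + X (i + 1) = 2 * c + 1 - i) := fun i => by
      have := hX i
      have := hX (i + 1)
      omega
    refine ⟨X, ?_, ?_, ?_, ?_, ?_, ?_⟩
    · have := hX 0; omega
    · have := hX (4 * c + 3 + 1); omega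
    · intro i hi j hj; have := hX i; have := hX j; omega
    · intro i hi; have := hX i; omega
    · intro _ i hi j hj; have := hS i; have := hS j; omega
    · intro i hi; have := hS i; omega
  · obtain ⟨c, hc, rfl⟩ : ∃ c, 1 ≤ c ∧ p = 4 * c + 1 := ⟨p / 4, by omega, by omega⟩
    -- The value `c + 1` at the odd index `2c + 3` breaks the alternation of signs and yields the
    -- two large sums `2c + 1` and `2c`; the value at `1` yields `-(2c + 1)` and `0`.
    let X : ℕ → ℤ := fun i => if i % 2 = 0 then
      (if i = 0 then 0 else if i ≤ 2 * c then 2 * c + 2 - (i / 2 : ℕ) else 2 * c + 1 - (i / 2 : ℕ))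
      else if i = 1 then -(2 * c + 1) else if i ≤ 2 * c + 1 then -(i / 2 : ℕ) - 1
      else if i = 2 * c + 3 then c + 1 else -(i / 2 : ℕ)
    have hX : ∀ i, (i = 0 ∧ X i = 0) ∨
        (i % 2 = 0 ∧ 0 < i ∧ i ≤ 2 * c ∧ 2 * X i = 4 * c + 4 - i) ∨
        (i % 2 = 0 ∧ 2 * c < i ∧ 2 * X i = 4 * c + 2 - i) ∨
        (i = 1 ∧ X i = -(2 * c + 1)) ∨
        (i % 2 = 1 ∧ 1 < i ∧ i ≤ 2 * c + 1 ∧ 2 * X i = -i - 1) ∨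
        (i = 2 * c + 3 ∧ X i = c + 1) ∨
        (i % 2 = 1 ∧ 2 * c + 3 < i ∧ 2 * X i = 1 - i) := by
      intro i
      simp only [X]
      split_ifs <;> omega
    clear_value X
    have hS : ∀ i, (i = 0 ∧ X i + X (i + 1) = -(2 * c + 1)) ∨
        (i = 1 ∧ X i + X (i + 1) = 0) ∨
        (i = 2 * c + 1 ∧ X i + X (i + 1) = -1) ∨
        (i = 2 * c + 2 ∧ X i + X (i + 1) = 2 * c + 1) ∨
        (i = 2 * c + 3 ∧ X i + X (i + 1) = 2 * c) ∨
        (2 ≤ i ∧ i ≤ 2 * c ∧ X i + X (i + 1) = 2 * c + 1 - i) ∨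
        (2 * c + 4 ≤ i ∧ X i + X (i + 1) = 2 * c + 1 - i) := fun i => by
      have h1 := hX i
      have h2 := hX (i + 1)
      obtain h | h | h | h | h | h | h : i = 0 ∨ i = 1 ∨ i = 2 * c + 1 ∨ i = 2 * c + 2 ∨
          i = 2 * c + 3 ∨ (2 ≤ i ∧ i ≤ 2 * c) ∨ 2 * c + 4 ≤ i := by omega
      · exact .inl ⟨h, by omega⟩
      · exact .inr (.inl ⟨h, by omega⟩)
      · exact .inr (.inr (.inl ⟨h, by omega⟩))
      · exact .inr (.inr (.inr (.inl ⟨h, by omega⟩)))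
      · exact .inr (.inr (.inr (.inr (.inl ⟨h, by omega⟩))))
      · exact .inr (.inr (.inr (.inr (.inr (.inl ⟨h.1, h.2, by omega⟩)))))
      · exact .inr (.inr (.inr (.inr (.inr (.inr ⟨h, by omega⟩)))))
    refine ⟨X, ?_, ?_, ?_, ?_, ?_, ?_⟩
    · have := hX 0; omega
    · have := hX (4 * c + 1 + 1); omega
    · intro i hi j hj
      have h1 := hX i
      have h2 := hX j
      rcases h1 with h1 | h1 | h1 | h1 | h1 | h1 | h1 <;> omega
    · intro i hi; have := hX i; omega
    · intro _ i hi j hj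
      have h1 := hS i
      have h2 := hS j
      rcases h1 with h1 | h1 | h1 | h1 | h1 | h1 | h1 <;> omega
    · intro i hi; have := hS i; omega

theorem exists_paired_labels {V W : Type*} [DecidableEq V] [DecidableEq W] (f : V → W) (k : ℕ) :
    ∀ (a : ℕ) (S : Finset V), S.card = 2 * k → (∀ u, Even (S.filter (f · = u)).card) →
      ∃ l : V → ℕ, Set.BijOn l S (Set.Icc (a + 1) (a + 2 * k)) ∧
        ∀ u, (2 * a + 2 * k + 1) ∣ ∑ w ∈ S.filter (f · = u), l w := by
  induction k with
  | zero =>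
    intro a S hS _
    obtain rfl : S = ∅ := by simpa using hS
    exact ⟨fun _ => 0, by simp, by simp⟩
  | succ k ih =>
    intro a S hS he
    obtain ⟨x, hx⟩ : S.Nonempty := by rw [← Finset.card_pos]; omega
    have hxf : x ∈ S.filter (f · = f x) := by simp [hx]
    obtain ⟨y, hy, hyx⟩ : ∃ y ∈ S.filter (f · = f x), y ≠ x := by
      apply Finset.exists_mem_ne
      have h1 := Finset.card_pos.2 ⟨x, hxf⟩
      have h2 := he (f x)
      rcases h2 with ⟨t, ht⟩
      omega
    rw [Finset.mem_filter] at hy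
    set S' := (S.erase x).erase y with hS'
    have hyS : y ∈ S.erase x := Finset.mem_erase.2 ⟨hyx, hy.1⟩
    have hxS' : x ∉ S' := by simp [hS']
    have hyS' : y ∉ S' := by simp [hS']
    have hins : S = insert x (insert y S') := by
      rw [hS', Finset.insert_erase hyS, Finset.insert_erase hx]
    have hxI : x ∉ insert y S' := by simp [hxS', hyx.symm]
    have hcard : S'.card = 2 * k := by
      rw [hS', Finset.card_erase_of_mem hyS, Finset.card_erase_of_mem hx]; omega
    obtain ⟨l, hl, hd⟩ := ih (a + 1) S' hcard (by
      intro u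
      have := he u
      rw [hins, Finset.filter_insert, Finset.filter_insert, hy.2] at this
      split_ifs at this with h
      · rw [Finset.card_insert_of_notMem (by simp [hxS', hyx.symm]),
          Finset.card_insert_of_notMem (by simp [hyS'])] at this
        rw [Nat.even_iff] at this ⊢
        omega
      · exact this)
    -- The outermost labels go to one sibling pair; passing from `(a, k + 1)` to `(a + 1, k)` leaves
    -- the modulus unchanged.
    let l' := Function.update (Function.update l x (a + 1)) y (a + 2 * (k + 1))
    have hlx : l' x = a + 1 := by simp [l', Function.update_of_ne hyx.symm]
    have hly : l' y = a + 2 * (k + 1) := by simp [l']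
    have hlS : ∀ w ∈ S', l' w = l w := by
      intro w hw
      have h1 : w ≠ x := fun h => hxS' (h ▸ hw)
      have h2 : w ≠ y := fun h => hyS' (h ▸ hw)
      simp [l', Function.update_of_ne h1, Function.update_of_ne h2]
    refine ⟨l', ?_, ?_⟩
    · have h1 : Set.BijOn l' S' (Set.Icc (a + 1 + 1) (a + 1 + 2 * k)) :=
        hl.congr fun w hw => (hlS w hw).symm
      have h2 := (h1.insert (a := y) (by rw [hly]; simp; omega)).insert (a := x) (by
        rw [hlx, hly]; simp; omega)
      rw [hins]
      push_cast
      convert h2 using 1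
      ext t
      simp only [Set.mem_Icc, Set.mem_insert_iff, hlx, hly]
      omega
    · intro u
      have hsum : ∑ w ∈ S'.filter (f · = u), l' w = ∑ w ∈ S'.filter (f · = u), l w :=
        Finset.sum_congr rfl fun w hw => hlS w (Finset.mem_filter.1 hw).1
      have hdu := hd u
      rw [show 2 * (a + 1) + 2 * k + 1 = 2 * a + 2 * (k + 1) + 1 by ring] at hdu
      rw [hins, Finset.filter_insert, Finset.filter_insert, hy.2]
      split_ifs with h
      · rw [Finset.sum_insert (by simp [hxS', hyx.symm]), Finset.sum_insert (by simp [hyS']),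
          hsum, hlx, hly, ← add_assoc]
        exact dvd_add ⟨1, by ring⟩ hdu
      · rw [hsum]; exact hdu

/-! ### The labeling for a parent function -/

theorem exists_rooted_labels {V : Type*} [Fintype V] [DecidableEq V] (par : V → V) (v : ℕ → V)
    (p : ℕ) (hp : 1 ≤ p) (hinj : Set.InjOn v (Set.Icc 0 p)) (hroot : par (v 0) = v 0)
    (hpar : ∀ i < p, par (v (i + 1)) = v i)
    (heven : ∀ u, Even (Finset.univ.filter fun w => (∀ i ≤ p, w ≠ v i) ∧ par w = u).card)
    (hone : p = 1 → (∀ w, par w = v 0 → w = v 0 ∨ w = v 1) ∧ ∃ w, w ≠ v 0 ∧ par w = v 1) :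
    ∃ l : V → ℕ, l (v 0) = 0 ∧
      Set.BijOn l {v 0}ᶜ (Set.Icc 1 (Fintype.card V - 1)) ∧
      Function.Injective fun u => l u + ∑ w ∈ Finset.univ.filter (par · = u), l w := by
  classical
  set S : Finset V := Finset.univ.filter fun w => ∀ i ≤ p, w ≠ v i with hS
  have hSmem : ∀ w, w ∈ S ↔ ∀ i ≤ p, w ≠ v i := by simp [hS]
  set Q : Finset V := (Finset.range (p + 1)).image v with hQ
  have hSQ : Sᶜ = Q := by
    ext w
    simp only [Finset.mem_compl, hSmem, hQ, Finset.mem_image, Finset.mem_range]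
    push Not
    exact ⟨fun ⟨i, h, e⟩ => ⟨i, by omega, e.symm⟩, fun ⟨i, h, e⟩ => ⟨i, by omega, e.symm⟩⟩
  have hvinj : Set.InjOn v (Finset.range (p + 1)) := by
    intro i hi j hj h
    simp only [Finset.coe_range, Set.mem_Iio] at hi hj
    exact hinj ⟨by omega, by omega⟩ ⟨by omega, by omega⟩ h
  have hQcard : Q.card = p + 1 := by
    rw [hQ, Finset.card_image_of_injOn hvinj, Finset.card_range]
  have heven' : ∀ u, Even (S.filter (par · = u)).card := by
    intro u
    rw [hS, Finset.filter_filter]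
    exact heven u
  clear_value S Q
  obtain ⟨k, hk⟩ : ∃ k, S.card = 2 * k := by
    have : Even S.card := by
      rw [Finset.card_eq_sum_card_fiberwise (f := par) (t := Finset.univ) (by simp)]
      exact Finset.even_sum _ fun u _ => heven' u
    exact even_iff_exists_two_mul.1 this
  have hV : Fintype.card V = 2 * k + p + 1 := by
    rw [← Finset.card_add_card_compl S, hSQ, hk, hQcard, add_assoc]
  obtain ⟨X, hX0, hXp, hXinj, hXb, hXsinj, hXsb⟩ := exists_path_residues p hp
  set a := (p + 1) / 2 with ha
  obtain ⟨l₀, hl₀, hdvd⟩ := exists_paired_labels par k a S hk heven'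
  set C := 2 * a + 2 * k + 1 with hC
  -- The representative of `X i` modulo `C` in `[0, C)`.
  let pl : ℕ → ℕ := fun i => if 0 ≤ X i then (X i).toNat else (C + X i).toNat
  have hpl0 : pl 0 = 0 := by simp [pl, hX0]
  have hplp : pl (p + 1) = 0 := by simp [pl, hXp]
  have hplb : ∀ i ∈ Set.Icc 1 p, (1 ≤ pl i ∧ pl i ≤ a ∧ (pl i : ℤ) = X i) ∨
      (a + 2 * k + 1 ≤ pl i ∧ pl i ≤ 2 * k + p ∧ (pl i : ℤ) = X i + C) := by
    intro i hi
    obtain ⟨h1, h2, h3⟩ := hXb i hi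
    rw [abs_le] at h2
    rw [Nat.odd_iff] at h3
    simp only [pl]
    split_ifs with h
    · left; omega
    · right; omega
  have hplmod : ∀ i ≤ p + 1, (C : ℤ) ∣ pl i - X i := by
    intro i hi
    rcases Nat.eq_zero_or_pos i with rfl | h0
    · simp [hpl0, hX0]
    rcases Nat.eq_or_lt_of_le hi with rfl | h1
    · simp [hplp, hXp]
    rcases hplb i ⟨h0, by omega⟩ with h | h <;> rw [h.2.2] <;> simp
  let l : V → ℕ := fun w => if w ∈ S then l₀ w else pl (Function.invFunOn v (Set.Icc 0 p) w)
  have hlS : ∀ w ∈ S, l w = l₀ w := fun w hw => by simp [l, hw]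
  have hvS : ∀ i ≤ p, v i ∉ S := fun i hi h => (hSmem _).1 h i hi rfl
  have hlv : ∀ i ≤ p, l (v i) = pl i := by
    intro i hi
    simp only [l, hvS i hi, if_false]
    rw [hinj.leftInvOn_invFunOn ⟨by omega, hi⟩]
  have hcases : ∀ u, u ∈ S ∨ ∃ i ≤ p, u = v i := by
    intro u
    by_cases h : u ∈ S
    · exact .inl h
    · rw [hSmem] at h
      push Not at h
      exact .inr h
  have hl₀b : ∀ w ∈ S, a + 1 ≤ l₀ w ∧ l₀ w ≤ a + 2 * k := fun w hw => hl₀.mapsTo hw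
  have hmaps : Set.MapsTo l {v 0}ᶜ (Set.Icc 1 (Fintype.card V - 1)) := by
    intro u hu
    rw [Set.mem_Icc, hV]
    rcases hcases u with h | ⟨i, hi, rfl⟩
    · rw [hlS u h]
      have := hl₀b u h
      omega
    · rw [hlv i hi]
      have hi0 : i ≠ 0 := by rintro rfl; exact hu rfl
      have := hplb i ⟨by omega, hi⟩
      omega
  have hlinj : Set.InjOn l {v 0}ᶜ := by
    intro u hu u' hu' h
    rcases hcases u with hs | ⟨i, hi, rfl⟩ <;> rcases hcases u' with hs' | ⟨j, hj, rfl⟩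
    · rw [hlS u hs, hlS u' hs'] at h
      exact hl₀.injOn hs hs' h
    · have hj0 : j ≠ 0 := by rintro rfl; exact hu' rfl
      rw [hlS u hs, hlv j hj] at h
      have := hplb j ⟨by omega, hj⟩
      have := hl₀b u hs
      omega
    · have hi0 : i ≠ 0 := by rintro rfl; exact hu rfl
      rw [hlS u' hs', hlv i hi] at h
      have := hplb i ⟨by omega, hi⟩
      have := hl₀b u' hs'
      omega
    · have hi0 : i ≠ 0 := by rintro rfl; exact hu rfl
      have hj0 : j ≠ 0 := by rintro rfl; exact hu' rfl
      rw [hlv i hi, hlv j hj] at h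
      have h1 := hplb i ⟨by omega, hi⟩
      have h2 := hplb j ⟨by omega, hj⟩
      have : X i = X j := by omega
      rw [hXinj ⟨by omega, hi⟩ ⟨by omega, hj⟩ this]
  have hbij : Set.BijOn l {v 0}ᶜ (Set.Icc 1 (Fintype.card V - 1)) := by
    refine ⟨hmaps, hlinj, ?_⟩
    have := Finset.surjOn_of_injOn_of_card_le (s := ({v 0}ᶜ : Finset V))
      (t := Finset.Icc 1 (Fintype.card V - 1)) l (by simpa using hmaps) (by simpa using hlinj)
      (by simp [Finset.card_compl])
    simpa using this
  have hsum : ∀ u, ∑ w ∈ Finset.univ.filter (par · = u), l w =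
      ∑ w ∈ S.filter (par · = u), l₀ w +
        ∑ i ∈ (Finset.range (p + 1)).filter (fun i => par (v i) = u), pl i := by
    intro u
    rw [Finset.sum_filter, ← Finset.sum_add_sum_compl S, hSQ, hQ, Finset.sum_image hvinj,
      ← Finset.sum_filter, ← Finset.sum_filter]
    congr 1
    · exact Finset.sum_congr rfl fun w hw => hlS w (Finset.mem_filter.1 hw).1
    · exact Finset.sum_congr rfl fun i hi =>
        hlv i (Nat.lt_succ_iff.1 (Finset.mem_range.1 (Finset.mem_filter.1 hi).1))
  have hsumS : ∀ u ∈ S,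
      ∑ i ∈ (Finset.range (p + 1)).filter (fun i => par (v i) = u), pl i = 0 := by
    intro u hu
    rw [Finset.sum_eq_zero]
    intro i hi
    rw [Finset.mem_filter, Finset.mem_range] at hi
    exfalso
    rcases i with _ | i
    · exact hvS 0 (by omega) (by rw [← hroot, hi.2]; exact hu)
    · exact hvS i (by omega) (by rw [← hpar i (by omega), hi.2]; exact hu)
  have hsumv : ∀ j ≤ p,
      ∑ i ∈ (Finset.range (p + 1)).filter (fun i => par (v i) = v j), pl i = pl (j + 1) := by
    intro j hj
    -- The root is its own parent, but contributes `pl 0 = 0`; the last vertex has no path child,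
    -- matching `pl (p + 1) = 0`.
    rw [Finset.sum_filter, Finset.sum_range_succ', hpl0]
    simp only [ite_self, add_zero]
    have : ∀ i ∈ Finset.range p, (if par (v (i + 1)) = v j then pl (i + 1) else 0) =
        if i = j then pl (i + 1) else 0 := by
      intro i hi
      rw [Finset.mem_range] at hi
      rw [hpar i hi]
      congr 1
      rw [hinj.eq_iff ⟨by omega, by omega⟩ ⟨by omega, hj⟩]
    rw [Finset.sum_congr rfl this, Finset.sum_ite_eq']
    split_ifs with h
    · rfl
    · obtain rfl : j = p := by rw [Finset.mem_range] at h; omega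
      exact hplp.symm
  set s : V → ℕ := fun u => l u + ∑ w ∈ Finset.univ.filter (par · = u), l w with hs
  have hresS : ∀ u ∈ S, (C : ℤ) ∣ s u - l₀ u := by
    intro u hu
    obtain ⟨t, ht⟩ := hdvd u
    exact ⟨t, by simp only [hs, hlS u hu, hsum, hsumS u hu, ht]; push_cast; ring⟩
  have hresv : ∀ j ≤ p, (C : ℤ) ∣ s (v j) - (X j + X (j + 1)) := by
    intro j hj
    obtain ⟨t, ht⟩ := hdvd (v j)
    obtain ⟨x, hx⟩ := hplmod j (by omega)
    obtain ⟨y, hy⟩ := hplmod (j + 1) (by omega)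
    refine ⟨t + x + y, ?_⟩
    simp only [hs, hlv j hj, hsum, hsumv j hj, ht]
    push_cast
    linear_combination hx + hy
  have hres : ∀ {x y : ℕ} {r t : ℤ}, x = y → (C : ℤ) ∣ x - r → (C : ℤ) ∣ y - t →
      |r - t| < C → r = t := by
    rintro x _ r t rfl h1 h2 h3
    have := dvd_sub h2 h1
    rw [show (x : ℤ) - t - (x - r) = r - t by ring] at this
    exact sub_eq_zero.1 (Int.eq_zero_of_abs_lt_dvd this h3)
  have hone' : p = 1 → s (v 0) < s (v 1) := by
    intro h1
    obtain ⟨h2, w, hw0, hw⟩ := hone h1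
    have hl1 : l (v 0) = 0 := by rw [hlv 0 (by omega), hpl0]
    have hs0 : s (v 0) = l (v 1) := by
      simp only [hs, hl1, zero_add]
      have : Finset.univ.filter (par · = v 0) = {v 0, v 1} := by
        ext x
        simp only [Finset.mem_filter, Finset.mem_univ, true_and, Finset.mem_insert,
          Finset.mem_singleton]
        refine ⟨h2 x, ?_⟩
        rintro (rfl | rfl)
        · exact hroot
        · exact hpar 0 (by omega)
      rw [this, Finset.sum_pair, hl1, zero_add]
      intro h
      exact absurd (hinj ⟨by omega, by omega⟩ ⟨by omega, by omega⟩ h) (by omega)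
    have hs1 : l w ≤ ∑ w ∈ Finset.univ.filter (par · = v 1), l w :=
      Finset.single_le_sum (f := l) (fun _ _ => Nat.zero_le _) (by simp [hw])
    have : 1 ≤ l w := (hmaps hw0).1
    simp only [hs] at hs0 ⊢
    omega
  refine ⟨l, by rw [hlv 0 (by omega), hpl0], hbij, ?_⟩
  intro u u' h
  change s u = s u' at h
  rcases hcases u with hu | ⟨i, hi, rfl⟩ <;> rcases hcases u' with hu' | ⟨j, hj, rfl⟩
  · have h1 := hl₀b u hu
    have h2 := hl₀b u' hu'
    have := hres h (hresS u hu) (hresS u' hu') (by rw [abs_lt]; omega)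
    exact hl₀.injOn hu hu' (by exact_mod_cast this)
  · have h1 := hl₀b u hu
    have h2 := hXsb j ⟨by omega, hj⟩
    rw [abs_le] at h2
    have := hres h (hresS u hu) (hresv j hj) (by rw [abs_lt]; omega)
    omega
  · have h1 := hl₀b u' hu'
    have h2 := hXsb i ⟨by omega, hi⟩
    rw [abs_le] at h2
    have := hres h (hresv i hi) (hresS u' hu') (by rw [abs_lt]; omega)
    omega
  · have h1 := hXsb i ⟨by omega, hi⟩
    have h2 := hXsb j ⟨by omega, hj⟩
    rw [abs_le] at h1 h2
    have h3 := hres h (hresv i hi) (hresv j hj) (by rw [abs_lt]; omega)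
    by_cases hp1 : p = 1
    · have := hone' hp1
      have hi' : i = 0 ∨ i = 1 := by omega
      have hj' : j = 0 ∨ j = 1 := by omega
      rcases hi' with rfl | rfl <;> rcases hj' with rfl | rfl <;> first | rfl | omega
    · rw [hXsinj hp1 ⟨by omega, hi⟩ ⟨by omega, hj⟩ h3]

/-! ### Rooting a tree -/

/-- The depth `d` is the distance to `r`. Two neighbours of `v` closer to `r` would give two paths
from `r` to `v`, so the parent is unique. -/
theorem SimpleGraph.IsTree.exists_parent {V : Type*} {T : SimpleGraph V} (hT : T.IsTree) (r : V) :
    ∃ (par : V → V) (d : V → ℕ), par r = r ∧ (∀ v, v ≠ r → T.Adj v (par v)) ∧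
      (∀ u v, T.Adj u v → par u = v ∨ par v = u) ∧ ∀ v, v ≠ r → d v = d (par v) + 1 := by
  have hex : ∀ v, v ≠ r → ∃ w, T.Adj v w ∧ T.dist r v = T.dist r w + 1 := by
    intro v hv
    obtain ⟨p, hp⟩ := hT.connected.exists_walk_length_eq_dist v r
    cases p with
    | nil => exact absurd rfl hv
    | cons h q =>
      rename_i w
      refine ⟨w, h, ?_⟩
      have h1 := SimpleGraph.dist_le q
      rw [SimpleGraph.Walk.length_cons, SimpleGraph.dist_comm] at hp
      rw [SimpleGraph.dist_comm] at h1
      rcases hT.dist_eq_dist_add_one_of_adj r h with h2 | h2 <;> omega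
  have huniq : ∀ v w w', T.Adj v w → T.Adj v w' → T.dist r v = T.dist r w + 1 →
      T.dist r v = T.dist r w' + 1 → w = w' := by
    intro v w w' h h' hd hd'
    obtain ⟨p, hp⟩ := hT.connected.exists_walk_length_eq_dist r w
    obtain ⟨p', hp'⟩ := hT.connected.exists_walk_length_eq_dist r w'
    have h1 : (p.concat h.symm).IsPath := SimpleGraph.Walk.isPath_of_length_eq_dist _ (by
      rw [SimpleGraph.Walk.length_concat, hp, hd])
    have h2 : (p'.concat h'.symm).IsPath := SimpleGraph.Walk.isPath_of_length_eq_dist _ (by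
      rw [SimpleGraph.Walk.length_concat, hp', hd'])
    have h3 := congrArg (fun q : T.Path r v => q.1.penultimate)
      ((hT.isAcyclic.subsingleton_path _ _).elim ⟨_, h1⟩ ⟨_, h2⟩)
    simpa using h3
  classical
  choose! f hf hd using hex
  refine ⟨fun v => if v = r then r else f v, T.dist r, by simp, ?_, ?_, ?_⟩
  · intro v hv
    simpa [hv] using hf v hv
  · have key : ∀ u v, T.Adj u v → T.dist r u = T.dist r v + 1 →
        (if u = r then r else f u) = v := by
      intro u v h h1
      have hu : u ≠ r := by rintro rfl; simp at h1
      rw [if_neg hu]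
      exact huniq u _ _ (hf u hu) h (hd u hu) h1
    intro u v h
    rcases hT.dist_eq_dist_add_one_of_adj r h with h1 | h1
    · exact .inl (key u v h h1)
    · exact .inr (key v u h.symm h1)
  · intro v hv
    simpa [hv] using hd v hv

namespace SimpleGraph

variable {V : Type*} [Fintype V] [DecidableEq V] {T : SimpleGraph V} [DecidableRel T.Adj]

theorem degree_eq_card_children {r : V} {par : V → V} (hroot : par r = r)
    (hadj : ∀ v, v ≠ r → T.Adj v (par v))
    (hpar : ∀ u v, T.Adj u v → par u = v ∨ par v = u) (hne : ∀ v, v ≠ r → par (par v) ≠ v)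
    (u : V) : T.degree u = (Finset.univ.filter fun w => w ≠ r ∧ par w = u).card +
      if u = r then 0 else 1 := by
  have hmem : ∀ w, w ≠ r ∧ par w = u → T.Adj u w := by
    rintro w ⟨hw, rfl⟩
    exact (hadj w hw).symm
  rw [← card_neighborFinset_eq_degree]
  split_ifs with h
  · subst h
    congr 1
    ext w
    simp only [mem_neighborFinset, Finset.mem_filter, Finset.mem_univ, true_and]
    exact ⟨fun h => ⟨h.ne', (hpar u w h).resolve_left fun h1 => h.ne (hroot.symm.trans h1)⟩, hmem w⟩
  · rw [← Finset.card_insert_of_notMem (a := par u)]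
    · congr 1
      ext w
      simp only [mem_neighborFinset, Finset.mem_filter, Finset.mem_univ, true_and,
        Finset.mem_insert]
      constructor
      · intro hw
        by_cases h1 : w = par u
        · exact .inl h1
        · have h2 := (hpar u w hw).resolve_left (Ne.symm h1)
          exact .inr ⟨fun h3 => h (by rw [← h2, h3, hroot]), h2⟩
      · rintro (rfl | hw)
        · exact hadj u h
        · exact hmem w hw
    · simp [hne u h]

/-- Sending `v ≠ r` to the edge `s(v, par v)` is a bijection onto the edges; `l r = 0` makes the
fixed point `par r = r` harmless in the sums. -/
theorem isAntimagic_of_rooted_labels (hT : T.IsTree) {r : V} {par : V → V} (hroot : par r = r)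
    (hadj : ∀ v, v ≠ r → T.Adj v (par v))
    (hpar : ∀ u v, T.Adj u v → par u = v ∨ par v = u) (hne : ∀ v, v ≠ r → par (par v) ≠ v)
    {l : V → ℕ} (hlr : l r = 0) (hl : Set.BijOn l {r}ᶜ (Set.Icc 1 (Fintype.card V - 1)))
    (hinj : Function.Injective fun u => l u + ∑ w ∈ Finset.univ.filter (par · = u), l w) :
    T.IsAntimagic := by
  have hcard : T.edgeFinset.card = Fintype.card V - 1 := by
    have := hT.card_edgeFinset
    omega
  let e : {v : V // v ≠ r} → T.edgeSet := fun v => ⟨s(v.1, par v.1), hadj v.1 v.2⟩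
  have he : Function.Bijective e := by
    constructor
    · rintro ⟨v, hv⟩ ⟨w, hw⟩ h
      have h : s(v, par v) = s(w, par w) := congrArg Subtype.val h
      rw [Sym2.eq_iff] at h
      rcases h with h | ⟨h1, h2⟩
      · exact Subtype.ext h.1
      · exact absurd (by rw [h2, ← h1]) (hne v hv)
    · rintro ⟨x, hx⟩
      induction x with | _ u v
      have h := hpar u v hx
      have huv : T.Adj u v := hx
      have key : ∀ {u v}, T.Adj u v → par u = v → u ≠ r := by
        rintro u v h1 rfl rfl
        exact h1.ne hroot.symm
      rcases h with h | h
      · exact ⟨⟨u, key huv h⟩, by simp [e, h]⟩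
      · exact ⟨⟨v, key huv.symm h⟩, by simp [e, h, Sym2.eq_swap]⟩
  let E := Equiv.ofBijective e he
  refine ⟨fun x => l (E.symm x), ?_, ?_⟩
  · rw [hcard]
    refine ⟨fun x _ => hl.mapsTo (E.symm x).2, ?_, ?_⟩
    · intro x _ y _ h
      exact E.symm.injective (Subtype.ext (hl.injOn (E.symm x).2 (E.symm y).2 h))
    · intro n hn
      obtain ⟨v, hv, rfl⟩ := hl.surjOn hn
      exact ⟨E ⟨v, hv⟩, trivial, by simp⟩
  · convert hinj using 2 with u
    rw [vertexSum, Finset.sum_filter, ← E.sum_comp]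
    simp only [Equiv.symm_apply_apply]
    have h1 : ∀ v : {v : V // v ≠ r}, (if u ∈ (E v : Sym2 V) then l v else 0) =
        (if (v : V) = u then l v else 0) + if par v = u then l v else 0 := by
      intro v
      have : (E v : Sym2 V) = s(v.1, par v.1) := rfl
      simp only [this, Sym2.mem_iff]
      have h2 := (hadj v v.2).ne
      by_cases h3 : (v : V) = u
      · subst h3; simp [h2.symm]
      · simp [h3, Ne.symm h3, eq_comm]
    rw [Finset.sum_congr rfl fun v _ => h1 v]
    have h2 := Finset.sum_subtype (Finset.univ.filter (· ≠ r)) (p := (· ≠ r)) (F := inferInstance)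
      (by simp)
      (fun v => (if v = u then l v else 0) + if par v = u then l v else 0)
    rw [← h2, Finset.sum_filter_of_ne, Finset.sum_add_distrib, Finset.sum_ite_eq',
      Finset.sum_filter]
    · simp
    · rintro v _ h rfl
      simp [hlr] at h

/-! ### From the path to the theorem -/

theorem isAntimagic_of_path (hT : T.IsTree) (v : ℕ → V) (p : ℕ) (hp : 1 ≤ p)
    (hadjv : ∀ i < p, T.Adj (v i) (v (i + 1))) (hback : ∀ i, i + 2 ≤ p → v (i + 2) ≠ v i)
    (hdeg : ∀ u, Even (T.degree u) ↔ ∃ j, 0 < j ∧ j < p ∧ u = v j)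
    (hone : p = 1 → T.degree (v 0) = 1 ∧ T.degree (v 1) ≠ 1) : T.IsAntimagic := by
  obtain ⟨par, d, hroot, hadj, hpar, hd⟩ := hT.exists_parent (v 0)
  have hne : ∀ u, u ≠ v 0 → par (par u) ≠ u := by
    intro u hu h
    have h1 := hd u hu
    by_cases h2 : par u = v 0
    · rw [h2, hroot] at h
      exact hu h.symm
    · have h3 := hd _ h2
      rw [h] at h3
      omega
  have hparv : ∀ i < p, par (v (i + 1)) = v i := by
    intro i
    induction i with
    | zero =>
      intro hi
      exact (hpar _ _ (hadjv 0 hi)).resolve_left fun h => (hadjv 0 hi).ne (hroot.symm.trans h)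
    | succ i ih =>
      intro hi
      -- A step towards the root would return to `v i`, so the walk keeps descending; injectivity of
      -- `v` follows by depth.
      refine (hpar _ _ (hadjv (i + 1) hi)).resolve_left fun h => hback i (by omega) ?_
      rw [← ih (by omega), ← h]
  have hdv : ∀ i ≤ p, d (v i) = d (v 0) + i := by
    intro i
    induction i with
    | zero => simp
    | succ i ih =>
      intro hi
      have h1 : v (i + 1) ≠ v 0 := by
        intro h
        have h2 := hparv i hi
        rw [h, hroot, ← h] at h2
        exact (hadjv i hi).ne h2.symm
      rw [hd _ h1, hparv i hi, ih (by omega), add_assoc]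
  have hinj : Set.InjOn v (Set.Icc 0 p) := by
    intro i hi j hj h
    have h1 := hdv i hi.2
    rw [h, hdv j hj.2] at h1
    omega
  have hcard := degree_eq_card_children hroot hadj hpar hne
  suffices h : _ ∧ _ by
    obtain ⟨l, hl0, hl, hlinj⟩ := exists_rooted_labels par v p hp hinj hroot hparv h.1 h.2
    exact isAntimagic_of_rooted_labels hT hroot hadj hpar hne hl0 hl hlinj
  constructor
  · intro u
    set F := Finset.univ.filter fun w => (∀ i ≤ p, w ≠ v i) ∧ par w = u with hF
    have hdu := hdeg u
    have hcu := hcard u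
    have hchild : ∀ w, w ≠ v 0 ∧ par w = u ↔
        ((∀ i ≤ p, w ≠ v i) ∧ par w = u) ∨ ∃ j < p, w = v (j + 1) ∧ u = v j := by
      intro w
      constructor
      · rintro ⟨hw, rfl⟩
        by_cases h : ∀ i ≤ p, w ≠ v i
        · exact .inl ⟨h, rfl⟩
        · push Not at h
          obtain ⟨i, hi, rfl⟩ := h
          cases i with
          | zero => exact absurd rfl hw
          | succ i => exact .inr ⟨i, hi, rfl, hparv i hi⟩
      · rintro (⟨h1, h2⟩ | ⟨j, hj, rfl, rfl⟩)
        · exact ⟨h1 0 (by omega), h2⟩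
        · exact ⟨hinj.ne ⟨by omega, hj⟩ ⟨by omega, by omega⟩ (by omega), hparv j hj⟩
    by_cases h : ∃ j < p, u = v j
    · obtain ⟨j, hj, rfl⟩ := h
      have h1 : (Finset.univ.filter fun w => w ≠ v 0 ∧ par w = v j) = insert (v (j + 1)) F := by
        ext w
        simp only [hF, Finset.mem_filter, Finset.mem_univ, true_and, Finset.mem_insert, hchild w]
        rw [or_comm]
        refine or_congr_left ⟨?_, fun h => ⟨j, hj, h, rfl⟩⟩
        rintro ⟨i, hi, rfl, h⟩
        rw [hinj ⟨by omega, by omega⟩ ⟨by omega, by omega⟩ h]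
      have h2 : v (j + 1) ∉ F := fun h => (Finset.mem_filter.1 h).2.1 (j + 1) hj rfl
      rw [h1, Finset.card_insert_of_notMem h2] at hcu
      by_cases hj0 : j = 0
      · subst hj0
        have h3 : ¬ Even (T.degree (v 0)) := by
          rw [hdu]
          rintro ⟨i, hi, hip, h⟩
          have := hinj ⟨by omega, by omega⟩ ⟨by omega, by omega⟩ h
          omega
        rw [hcu, Nat.even_iff] at h3
        rw [Nat.even_iff]
        simp only [if_true] at h3
        omega
      · have h3 : Even (T.degree (v j)) := hdu.2 ⟨j, by omega, hj, rfl⟩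
        rw [hcu, if_neg (hinj.ne ⟨by omega, by omega⟩ ⟨by omega, by omega⟩ hj0),
          Nat.even_iff] at h3
        rw [Nat.even_iff]
        omega
    · have h1 : (Finset.univ.filter fun w => w ≠ v 0 ∧ par w = u) = F := by
        ext w
        simp only [hF, Finset.mem_filter, Finset.mem_univ, true_and, hchild w]
        exact or_iff_left fun ⟨j, hj, _, hu⟩ => h ⟨j, hj, hu⟩
      have h2 : u ≠ v 0 := fun hu => h ⟨0, by omega, hu⟩
      have h3 : ¬ Even (T.degree u) := fun he =>
        let ⟨j, _, hj, hu⟩ := hdu.1 he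
        h ⟨j, hj, hu⟩
      rw [hcu, h1, if_neg h2, Nat.even_iff] at h3
      rw [Nat.even_iff]
      omega
  · rintro rfl
    obtain ⟨h1, h2⟩ := hone rfl
    constructor
    · intro w hw
      by_contra! h
      have h3 : T.Adj (v 0) w := by
        rw [← hw]
        exact (hadj w h.1).symm
      rw [degree_eq_one_iff_existsUnique_adj] at h1
      exact h.2 (h1.unique h3 (hadjv 0 (by omega)))
    · have h10 : v 1 ≠ v 0 := (hadjv 0 (by omega)).ne'
      rw [hcard, if_neg h10] at h2
      have h3 : (Finset.univ.filter fun w => w ≠ v 0 ∧ par w = v 1).Nonempty := by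
        rw [← Finset.card_pos]
        omega
      obtain ⟨w, hw⟩ := h3
      exact ⟨w, by simpa using hw⟩

theorem isAntimagic_of_subsingleton [Subsingleton V] : T.IsAntimagic := by
  have h : IsEmpty T.edgeSet := by
    rw [Subsingleton.elim T ⊥]
    simp
  refine ⟨fun _ => 0, ?_, Function.injective_of_subsingleton _⟩
  have h1 : T.edgeFinset.card = 0 := by
    rw [edgeFinset_card, Fintype.card_eq_zero]
  rw [h1, Set.univ_eq_empty_iff.2 h]
  simp

theorem Connected.nonempty_iso_completeGraph_two (hT : T.Connected) {u w : V} (h : T.Adj u w)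
    (hu : T.degree u = 1) (hw : T.degree w = 1) : Nonempty (T ≃g completeGraph (Fin 2)) := by
  rw [degree_eq_one_iff_existsUnique_adj] at hu hw
  have key : ∀ {x y : V}, T.Walk x y → x = u ∨ x = w → y = u ∨ y = w := by
    intro x y q
    induction q with
    | nil => exact id
    | cons hxy q ih =>
      rintro (rfl | rfl)
      · exact ih (.inr (hu.unique hxy h))
      · exact ih (.inl (hw.unique hxy h.symm))
  have hall : ∀ y, y = u ∨ y = w := fun y => key (hT u y).some (.inl rfl)
  have htop : T = ⊤ := by
    ext x y
    simp only [top_adj]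
    refine ⟨Adj.ne, fun hxy => ?_⟩
    rcases hall x with rfl | rfl <;> rcases hall y with rfl | rfl
    · exact absurd rfl hxy
    · exact h
    · exact h.symm
    · exact absurd rfl hxy
  have hcard : Fintype.card V = 2 := by
    rw [← Finset.card_univ, ← Finset.card_pair h.ne]
    congr 1
    ext y
    simpa using hall y
  subst htop
  exact ⟨Iso.completeGraph (Fintype.equivFinOfCardEq hcard)⟩

end SimpleGraph

theorem mainTheorem2 {V : Type*} [Fintype V] [DecidableEq V]
    (T : SimpleGraph V) [DecidableRel T.Adj] (hT : T.IsTree)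
    (hK2 : ¬ Nonempty (T ≃g SimpleGraph.completeGraph (Fin 2)))
    (hpath : T.InducesPath T.evenDegreeVertices) :
    T.IsAntimagic := by
  rcases subsingleton_or_nontrivial V with hV | hV
  · exact SimpleGraph.isAntimagic_of_subsingleton
  obtain ⟨n, ⟨f⟩⟩ := hpath
  rcases Nat.eq_zero_or_pos n with rfl | hn
  · obtain ⟨u, hu⟩ := hT.exists_vert_degree_one_of_nontrivial
    obtain ⟨w, huw, -⟩ := SimpleGraph.degree_eq_one_iff_existsUnique_adj.1 hu
    refine SimpleGraph.isAntimagic_of_path hT (fun i => if i = 0 then u else w) 1 le_rfl ?_ ?_ ?_ ?_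
    · intro i hi
      obtain rfl : i = 0 := by omega
      simpa using huw
    · intro i hi
      omega
    · intro x
      refine iff_of_false (fun hx => (f ⟨x, hx⟩).elim0) ?_
      rintro ⟨j, h1, h2, -⟩
      omega
    · intro _
      simpa [hu] using fun hw => hK2 (hT.connected.nonempty_iso_completeGraph_two huw hu hw)
  · let e : ℕ → V := fun i => if h : i < n then f.symm ⟨i, h⟩ else Classical.arbitrary V
    have he : ∀ i (h : i < n), e i = f.symm ⟨i, h⟩ := fun i h => by simp [e, h]
    have heven : ∀ i < n, Even (T.degree (e i)) := by
      intro i h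
      rw [he i h]
      exact (f.symm ⟨i, h⟩).2
    have hex : ∀ u, Even (T.degree u) → ∃ i < n, u = e i := by
      intro u hu
      refine ⟨f ⟨u, hu⟩, (f ⟨u, hu⟩).2, ?_⟩
      rw [he _ (f ⟨u, hu⟩).2]
      simp
    have hadj : ∀ i j, i < n → j < n → (T.Adj (e i) (e j) ↔ i + 1 = j ∨ j + 1 = i) := by
      intro i j hi hj
      rw [he i hi, he j hj]
      have := f.symm.map_adj_iff (v := ⟨i, hi⟩) (w := ⟨j, hj⟩)
      rw [SimpleGraph.pathGraph_adj] at this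
      simpa using this
    have hinj : ∀ i j, i < n → j < n → e i = e j → i = j := by
      intro i j hi hj h
      rw [he i hi, he j hj] at h
      simpa using f.symm.injective (Subtype.ext h)
    have hnbr : ∀ i < n, ∀ x, ∃ w, T.Adj (e i) w ∧ w ≠ x := by
      intro i hi x
      have h1 : 1 < (T.neighborFinset (e i)).card := by
        rw [SimpleGraph.card_neighborFinset_eq_degree]
        have h2 := hT.connected.preconnected.degree_pos_of_nontrivial (e i)
        have h3 := Nat.even_iff.1 (heven i hi)
        omega
      obtain ⟨w, hw, hwx⟩ := Finset.exists_mem_ne h1 x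
      exact ⟨w, by simpa using hw, hwx⟩
    obtain ⟨w₀, hw₀, hne₀⟩ := hnbr 0 hn (e 1)
    have hodd₀ : ¬ Even (T.degree w₀) := by
      intro h
      obtain ⟨i, hi, rfl⟩ := hex _ h
      rw [hadj 0 i hn hi] at hw₀
      obtain rfl : i = 1 := by omega
      exact hne₀ rfl
    -- For `n = 1` both end vertices hang on the same even vertex, so `w₀` itself has to be avoided.
    obtain ⟨w₁, hw₁, hne₁⟩ := hnbr (n - 1) (by omega) (if n = 1 then w₀ else e (n - 2))
    have hodd₁ : ¬ Even (T.degree w₁) := by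
      intro h
      obtain ⟨i, hi, rfl⟩ := hex _ h
      rw [hadj (n - 1) i (by omega) hi] at hw₁
      obtain rfl : i = n - 2 := by omega
      rw [if_neg (by omega)] at hne₁
      exact hne₁ rfl
    let v : ℕ → V := fun i => if i = 0 then w₀ else if i ≤ n then e (i - 1) else w₁
    have hv0 : v 0 = w₀ := rfl
    have hve : ∀ i < n, v (i + 1) = e i := fun i hi => by
      simp [v, Nat.succ_le_of_lt hi]
    have hvn : v (n + 1) = w₁ := by simp [v]
    refine SimpleGraph.isAntimagic_of_path hT v (n + 1) (by omega) ?_ ?_ ?_ (by omega)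
    · intro i hi
      rcases i with _ | i
      · rw [hv0, hve 0 hn]
        exact hw₀.symm
      · rw [hve i (by omega)]
        by_cases h : i + 1 < n
        · rw [hve _ h, hadj _ _ (by omega) h]
          exact .inl rfl
        · obtain rfl : n = i + 1 := by omega
          rw [hvn]
          exact hw₁
    · intro i hi
      by_cases h : i + 1 < n
      · rw [hve (i + 1) h]
        rcases i with _ | i
        · exact fun h1 => hodd₀ (by rw [← hv0, ← h1]; exact heven _ h)
        · rw [hve i (by omega)]
          exact fun h1 => by have := hinj _ _ h (by omega) h1; omega
      · obtain rfl : n = i + 1 := by omega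
        rw [hvn]
        rcases i with _ | i
        · simpa [hv0] using hne₁
        · rw [hve i (by omega)]
          exact fun h1 => hodd₁ (by rw [h1]; exact heven _ (by omega))
    · intro u
      constructor
      · intro hu
        obtain ⟨i, hi, rfl⟩ := hex u hu
        exact ⟨i + 1, by omega, by omega, (hve i hi).symm⟩
      · rintro ⟨j, hj0, hj, rfl⟩
        obtain ⟨i, rfl⟩ : ∃ i, j = i + 1 := ⟨j - 1, by omega⟩
        rw [hve i (by omega)]
        exact heven i (by omega)
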